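/- Let $n\ge 0$. (1) Let $K$ be a (possibly infinite) simplicial complex, and suppose that there are classes $\xi_1,\dots,\xi_n\in H^1(K;\mathbb Z/2)$ in simplicial cohomology whose cup product $\xi_1\smile\dots\smile\xi_n\in H^n(K;\mathbb Z/2)$ is non-zero. Then $K$ has at least $2^n$ faces of dimension $n$. (2) Let $X$ be a regular simplicial set, and suppose that there are classes $\xi_1,\dots,\xi_n\in H^1(X;\mathbb Z/2)$ whose cup product $\xi_1\smile\dots\smile\xi_n\in H^n(X;\mathbb Z/2)$ is non-zero. Then $X$ has at least $2^n$ nondegenerate simplices of dimension $n$. Here a simplicial set is called regular if for every nondegenerate simplex $x$ of dimension $m\ge 1$ the square formed by the last face inclusion $\Delta^{m-1}\to\Delta^m$, the maps $\Delta^{m-1}\to\langle d_m x\rangle$ and $\Delta^m\to\langle x\rangle$, and the inclusion $\langle d_m x\rangle\subseteq\langle x\rangle$ is a pushout, where $\langle y\rangle$ is the simplicial subset generated by $y$; in particular, every simplicial set all of whose nondegenerate simplices $\Delta^m\to X$ are embedded is regular. For $n=0$ the empty product is the unit $1\in H^0$. -/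

import Mathlib

open CategoryTheory Opposite

universe u v

namespace SSet

/-! ### Simplicial cohomology and the cup product -/

section Cochains

open Simplicial

variable (X : SSet.{u}) (R : Type v) [CommRing R]

/-- The module `C^n(X; R)` of simplicial `n`-cochains: all functions on the set `X_n`
of `n`-simplices. -/
abbrev Cochain (n : ℕ) : Type (max u v) := X _⦋n⦌ → R

/-- The coboundary `C^n(X; R) → C^{n+1}(X; R)`, `(d c)(x) = ∑ i, (-1)^i c(d_i x)`. -/
def coboundary (n : ℕ) : X.Cochain R n →ₗ[R] X.Cochain R (n + 1) where
  toFun c := fun x => ∑ i : Fin (n + 2), (-1) ^ (i : ℕ) * c (X.δ i x)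
  map_add' a b := by
    funext x
    simp [mul_add, Finset.sum_add_distrib]
  map_smul' r a := by
    funext x
    simp only [Pi.smul_apply, smul_eq_mul, RingHom.id_apply, Finset.mul_sum]
    exact Finset.sum_congr rfl fun i _ => by ring

variable {X R}

lemma coboundary_apply {n : ℕ} (c : X.Cochain R n) (x : X _⦋n + 1⦌) :
    X.coboundary R n c x = ∑ i : Fin (n + 2), (-1) ^ (i : ℕ) * c (X.δ i x) := rfl

/-- The face `x(j, j+1, …, j+l)` of an `n`-simplex `x` on `l + 1` consecutive vertices. -/
def interval {n : ℕ} (j l : ℕ) (h : j + l ≤ n) (x : X _⦋n⦌) : X _⦋l⦌ :=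
  X.map (SimplexCategory.subinterval j l h).op x

/-- The cup product of cochains,
`(a ⌣ b)(x) = a(x(0, …, p)) * b(x(p, …, p + q))` for `x` of dimension `n = p + q`. -/
def cupCochain {p q n : ℕ} (h : p + q = n) (a : X.Cochain R p) (b : X.Cochain R q) :
    X.Cochain R n :=
  fun x => a (interval 0 p (by omega) x) * b (interval p q (by omega) x)

lemma map_op_congr {m n : ℕ} (f g : ⦋m⦌ ⟶ ⦋n⦌)
    (h : ∀ k : Fin (m + 1), (f.toOrderHom k : Fin (n + 1)).1 = (g.toOrderHom k : Fin (n + 1)).1)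
    (x : X _⦋n⦌) : X.map f.op x = X.map g.op x := by
  have : f = g := by
    ext k
    exact h k
  rw [this]

lemma interval_zero_δ_of_le {n p : ℕ} (hp : p ≤ n) (x : X _⦋n + 1⦌) (i : Fin (p + 2))
    (k : Fin (n + 2)) (hik : k.1 = i.1) :
    interval 0 p (by omega) (X.δ k x) = X.δ i (interval 0 (p + 1) (by omega) x) := by
  simp only [interval, SimplicialObject.δ_def, ← Functor.map_comp_apply, ← op_comp]
  refine map_op_congr _ _ (fun s => ?_) x
  change (Fin.succAbove k ⟨s.1 + 0, by omega⟩).1 = (Fin.succAbove i s).1 + 0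
  simp only [Fin.succAbove, Fin.lt_def, Fin.val_castSucc]
  split_ifs <;> simp_all

lemma interval_δ_of_le {n p q : ℕ} (h : p + q ≤ n) (x : X _⦋n + 1⦌)
    (k : Fin (n + 2)) (hk : k.1 ≤ p) :
    interval p q h (X.δ k x) = interval (p + 1) q (by omega) x := by
  simp only [interval, SimplicialObject.δ_def, ← Functor.map_comp_apply, ← op_comp]
  refine map_op_congr _ _ (fun s => ?_) x
  change (Fin.succAbove k ⟨s.1 + p, by omega⟩).1 = s.1 + (p + 1)
  simp only [Fin.succAbove, Fin.lt_def, Fin.val_castSucc]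
  split_ifs <;> simp <;> omega

lemma interval_zero_δ_of_lt {n p : ℕ} (hp : p ≤ n) (x : X _⦋n + 1⦌)
    (k : Fin (n + 2)) (hk : p < k.1) :
    interval 0 p (by omega) (X.δ k x) = interval 0 p (by omega) x := by
  simp only [interval, SimplicialObject.δ_def, ← Functor.map_comp_apply, ← op_comp]
  refine map_op_congr _ _ (fun s => ?_) x
  change (Fin.succAbove k ⟨s.1 + 0, by omega⟩).1 = s.1 + 0
  simp only [Fin.succAbove, Fin.lt_def, Fin.val_castSucc]
  split_ifs
  · simp
  · omega

lemma interval_δ_of_lt {n p q : ℕ} (h : p + q ≤ n) (x : X _⦋n + 1⦌) (j : Fin (q + 2))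
    (k : Fin (n + 2)) (hk : k.1 = p + j.1) :
    interval p q h (X.δ k x) = X.δ j (interval p (q + 1) (by omega) x) := by
  simp only [interval, SimplicialObject.δ_def, ← Functor.map_comp_apply, ← op_comp]
  refine map_op_congr _ _ (fun s => ?_) x
  change (Fin.succAbove k ⟨s.1 + p, by omega⟩).1 = (Fin.succAbove j s).1 + p
  simp only [Fin.succAbove, Fin.lt_def, Fin.val_castSucc]
  split_ifs <;> simp <;> omega

/-- The Leibniz rule. -/
lemma coboundary_cupCochain {p q n : ℕ} (h : p + q = n)
    (a : X.Cochain R p) (b : X.Cochain R q) :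
    X.coboundary R n (cupCochain h a b) =
      cupCochain (show p + 1 + q = n + 1 by omega) (X.coboundary R p a) b +
        ((-1 : R) ^ p) •
          cupCochain (show p + (q + 1) = n + 1 by omega) a (X.coboundary R q b) := by
  subst h
  funext x
  have hN : p + 1 + (q + 1) = p + q + 2 := by omega
  simp only [Pi.add_apply, Pi.smul_apply, smul_eq_mul, coboundary_apply, cupCochain]
  rw [← (finCongr hN).sum_comp, Fin.sum_univ_add,
    Fin.sum_univ_castSucc (n := p + 1), Fin.sum_univ_succ (n := q + 1)]
  set y := a (interval 0 p (show 0 + p ≤ p + q + 1 by omega) x)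
  set z := b (interval (p + 1) q (show p + 1 + q ≤ p + q + 1 by omega) x)
  set A : Fin (p + 1) → R := fun i =>
    a (X.δ i.castSucc (interval 0 (p + 1) (show 0 + (p + 1) ≤ p + q + 1 by omega) x))
  set B : Fin (q + 1) → R := fun j =>
    b (X.δ j.succ (interval p (q + 1) (show p + (q + 1) ≤ p + q + 1 by omega) x))
  have h5 : a (X.δ (Fin.last (p + 1))
      (interval 0 (p + 1) (show 0 + (p + 1) ≤ p + q + 1 by omega) x)) = y := by
    congr 1
    rw [← interval_zero_δ_of_lt (show p ≤ p + q by omega) x ⟨p + 1, by omega⟩ (by simp)]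
    exact (interval_zero_δ_of_le (by omega) x _ _ (by simp)).symm
  have h6 : b (X.δ 0 (interval p (q + 1) (show p + (q + 1) ≤ p + q + 1 by omega) x)) = z := by
    congr 1
    rw [← interval_δ_of_le (le_refl (p + q)) x ⟨p, by omega⟩ (by simp)]
    exact (interval_δ_of_lt _ x _ _ (by simp)).symm
  rw [h5, h6]
  trans (∑ i : Fin (p + 1), (-1) ^ i.1 * (A i * z)) +
    ∑ j : Fin (q + 1), (-1) ^ (p + 1 + j.1) * (y * B j)
  · congr 1
    · refine Finset.sum_congr rfl fun i _ => ?_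
      rw [interval_δ_of_le (le_refl (p + q)) x _ (by simp; omega),
        interval_zero_δ_of_le (show p ≤ p + q by omega) x i.castSucc _ (by simp)]
      simp [A, z]
    · refine Finset.sum_congr rfl fun j _ => ?_
      rw [interval_zero_δ_of_lt (show p ≤ p + q by omega) x _ (by simp; omega),
        interval_δ_of_lt (le_refl (p + q)) x j.succ _ (by simp; omega)]
      simp [B, y]
  · have e1 : ∑ i : Fin (p + 1), (-1) ^ i.1 * (A i * z) =
        (∑ i : Fin (p + 1), (-1) ^ i.1 * A i) * z := by
      rw [Finset.sum_mul]
      exact Finset.sum_congr rfl fun i _ => by ring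
    have e2 : ∑ j : Fin (q + 1), (-1) ^ (p + 1 + j.1) * (y * B j) =
        (-1) ^ p * (y * ∑ j : Fin (q + 1), (-1) ^ (j.1 + 1) * B j) := by
      rw [Finset.mul_sum, Finset.mul_sum]
      exact Finset.sum_congr rfl fun j _ => by ring
    rw [e1, e2]
    simp only [Fin.val_castSucc, Fin.val_last, Fin.val_zero, Fin.val_succ, A, B]
    ring

end Cochains

section Cohomology

variable (X : SSet.{u}) (R : Type v) [CommRing R]

/-- The `n`-cocycles. -/
def cocycles (n : ℕ) : Submodule R (X.Cochain R n) := LinearMap.ker (X.coboundary R n)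

/-- The `n`-coboundaries: the image of the coboundary from degree `n - 1`, zero if `n = 0`. -/
def coboundaries : (n : ℕ) → Submodule R (X.Cochain R n)
  | 0 => ⊥
  | n + 1 => LinearMap.range (X.coboundary R n)

/-- The cohomology `H^n(X; R)`: cocycles modulo coboundaries. -/
abbrev Cohomology (n : ℕ) : Type (max u v) :=
  X.cocycles R n ⧸ (X.coboundaries R n).submoduleOf (X.cocycles R n)

variable {X R}

lemma cupCochain_mem_cocycles {p q n : ℕ} (h : p + q = n) {a : X.Cochain R p}
    {b : X.Cochain R q} (ha : a ∈ X.cocycles R p) (hb : b ∈ X.cocycles R q) :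
    cupCochain h a b ∈ X.cocycles R n := by
  simp only [cocycles, LinearMap.mem_ker] at ha hb ⊢
  rw [coboundary_cupCochain, ha, hb]
  funext x
  simp [cupCochain]

lemma cupCochain_mem_coboundaries_left {p q n : ℕ} (h : p + q = n) {a : X.Cochain R p}
    {b : X.Cochain R q} (ha : a ∈ X.coboundaries R p) (hb : b ∈ X.cocycles R q) :
    cupCochain h a b ∈ X.coboundaries R n := by
  simp only [cocycles, LinearMap.mem_ker] at hb
  cases p with
  | zero =>
    obtain rfl : a = 0 := ha
    have : cupCochain h (0 : X.Cochain R 0) b = 0 := by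
      funext x
      simp [cupCochain]
    rw [this]
    exact zero_mem _
  | succ p =>
    obtain ⟨c, rfl⟩ := ha
    obtain ⟨m, rfl⟩ : ∃ m, n = m + 1 := ⟨p + q, by omega⟩
    refine ⟨cupCochain (show p + q = m by omega) c b, ?_⟩
    rw [coboundary_cupCochain, hb]
    funext x
    simp [cupCochain]

lemma cupCochain_mem_coboundaries_right {p q n : ℕ} (h : p + q = n) {a : X.Cochain R p}
    {b : X.Cochain R q} (ha : a ∈ X.cocycles R p) (hb : b ∈ X.coboundaries R q) :
    cupCochain h a b ∈ X.coboundaries R n := by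
  simp only [cocycles, LinearMap.mem_ker] at ha
  cases q with
  | zero =>
    obtain rfl : b = 0 := hb
    have : cupCochain h a (0 : X.Cochain R 0) = 0 := by
      funext x
      simp [cupCochain]
    rw [this]
    exact zero_mem _
  | succ q =>
    obtain ⟨c, rfl⟩ := hb
    obtain ⟨m, rfl⟩ : ∃ m, n = m + 1 := ⟨p + q, by omega⟩
    refine ⟨((-1 : R) ^ p) • cupCochain (show p + q = m by omega) a c, ?_⟩
    rw [map_smul, coboundary_cupCochain, ha, smul_add, smul_smul, ← mul_pow]
    funext x
    simp [cupCochain]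

/-- The cup product `H^p(X; R) × H^q(X; R) → H^n(X; R)`, `n = p + q`, induced by the cup
product of cocycles. -/
def cup {p q n : ℕ} (h : p + q = n) : X.Cohomology R p → X.Cohomology R q → X.Cohomology R n :=
  Quotient.map₂ (fun a b => ⟨cupCochain h a.1 b.1, cupCochain_mem_cocycles h a.2 b.2⟩) (by
    intro a a' haa b b' hbb
    have ha : a - a' ∈ (X.coboundaries R p).submoduleOf (X.cocycles R p) :=
      (Submodule.quotientRel_def _).1 haa
    have hb : b - b' ∈ (X.coboundaries R q).submoduleOf (X.cocycles R q) :=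
      (Submodule.quotientRel_def _).1 hbb
    replace ha : a.1 - a'.1 ∈ X.coboundaries R p := ha
    replace hb : b.1 - b'.1 ∈ X.coboundaries R q := hb
    refine (Submodule.quotientRel_def _).2 ?_
    have key : cupCochain h a.1 b.1 - cupCochain h a'.1 b'.1 =
        cupCochain h (a.1 - a'.1) b.1 + cupCochain h a'.1 (b.1 - b'.1) := by
      funext x
      simp only [cupCochain, Pi.sub_apply, Pi.add_apply]
      ring
    change cupCochain h a.1 b.1 - cupCochain h a'.1 b'.1 ∈ X.coboundaries R n
    rw [key]
    exact add_mem (cupCochain_mem_coboundaries_left h ha b.2)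
      (cupCochain_mem_coboundaries_right h a'.2 hb))

variable (X R)

/-- The unit `1 ∈ H^0(X; R)`, the class of the constant cochain `1`. -/
def cohomologyOne : X.Cohomology R 0 :=
  Submodule.Quotient.mk ⟨fun _ => 1, by
    simp only [cocycles, LinearMap.mem_ker]
    funext x
    simp [coboundary_apply]⟩

variable {X R}

/-- The cup product `ξ₁ ⌣ ⋯ ⌣ ξₙ ∈ H^n(X; R)` of `n` classes in `H^1(X; R)`; for `n = 0`
it is the unit `1 ∈ H^0(X; R)`. -/
def cupProd : (n : ℕ) → (Fin n → X.Cohomology R 1) → X.Cohomology R n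
  | 0, _ => X.cohomologyOne R
  | n + 1, ξ => cup rfl (cupProd n fun i => ξ i.castSucc) (ξ (Fin.last n))

end Cohomology

/-! ### Regular simplicial sets -/

section Regular

open Simplicial

/-- The last face `d_{n+1} x` of an `(n+1)`-simplex `x` generates a subcomplex of the one
generated by `x`. -/
lemma ofSimplex_lastFace_le {X : SSet.{u}} {n : ℕ} (x : X _⦋n + 1⦌) :
    Subcomplex.ofSimplex (X.δ (Fin.last (n + 1)) x) ≤ Subcomplex.ofSimplex x := by
  rw [Subcomplex.ofSimplex_le_iff]
  exact ⟨(SimplexCategory.δ (Fin.last (n + 1))).op, rfl⟩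

/-- A simplicial set is regular if, for every nondegenerate simplex `x` of positive dimension,
the subcomplex generated by `x` is obtained from the standard simplex by gluing along its last
face only: the square
```
  Δ[n]   ⟶ ⟨d_{n+1} x⟩
   |            |
   v            v
  Δ[n+1] ⟶    ⟨x⟩
```
is a pushout. (A nondegenerate `0`-simplex always generates a copy of `Δ[0]`.) -/
def IsRegular (X : SSet.{u}) : Prop :=
  ∀ (n : ℕ) (x : X _⦋n + 1⦌), x ∈ X.nonDegenerate (n + 1) →
    IsPushout (stdSimplex.δ (Fin.last (n + 1)))
      (Subcomplex.toOfSimplex (X.δ (Fin.last (n + 1)) x))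
      (Subcomplex.toOfSimplex x)
      (Subcomplex.homOfLE (ofSimplex_lastFace_le x))

/-- A simplicial set in which all nondegenerate simplices (equivalently, their boundaries) are
embedded is regular. -/
lemma Nonsingular.isRegular (X : SSet.{u}) [X.Nonsingular] : X.IsRegular := by
  intro n x hx
  have := Nonsingular.isIso_toOfSimplex x hx
  have := Nonsingular.isIso_toOfSimplex _ (nonDegenerate_δ hx (Fin.last (n + 1)))
  refine IsPushout.of_vert_isIso ⟨?_⟩
  rw [← cancel_mono (Subcomplex.ι _)]
  simp [stdSimplex.δ_comp_yonedaEquiv_symm]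

end Regular

end SSet

/-! ### Simplicial complexes -/

namespace PreAbstractSimplicialComplex

variable {V : Type u}

/-- The simplicial set of ordered simplices of a simplicial complex `K`: its `n`-simplices are
the sequences `(v₀, …, vₙ)`, repetitions allowed, of vertices of a common face of `K`. Its cochain
complex is the ordered cochain complex of `K`, so its cohomology is the simplicial cohomology
of `K`. -/
def ordered (K : PreAbstractSimplicialComplex V) : SSet.{u} where
  obj m := { f : Fin (m.unop.len + 1) → V // ∃ s ∈ K.faces, ∀ i, f i ∈ s }
  map θ := TypeCat.ofHom fun f => ⟨f.1 ∘ θ.unop.toOrderHom, by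
    obtain ⟨s, hs, h⟩ := f.2
    exact ⟨s, hs, fun i => h _⟩⟩

end PreAbstractSimplicialComplex

/-! Represent each class by a 1-cocycle. Adding the coboundary of a vertex function `c i` keeps the
class, and the product is then represented by the cochain whose value on an `n`-simplex is the
product of the `i`-th cocycle on the `i`-th consecutive edge. If an edge has distinct endpoints, a
random `c i` makes its label vanish with probability one half; independent choices leave a simplex
with non-zero value with probability at most `2 ^ (-n)`. So if fewer than `2 ^ n` simplices matter,
some choice kills the cocycle on all of them. `exists_cuts` is this averaging argument, one factor
at a time, and `two_pow_le_encard` the resulting bound.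

It remains to say which simplices matter. In a regular simplicial set these are the nondegenerate
ones: 1-cocycles vanish on degenerate edges, so the product vanishes on degenerate simplices, while
regularity gives nondegenerate edges distinct endpoints. In a simplicial complex, order the
vertices; the strictly increasing simplices inject into the faces, and a cocycle vanishing on them
is a coboundary because sorting is homotopic to the identity (`srtHomotopy_d`). -/

/-! ### Mod 2 cochains on lists -/

namespace ListCochain

variable {V : Type*}

/-- The simplicial coboundary mod 2 of a function on lists of vertices, where the empty list
counts as a face of each one-element list. -/
def d (g : List V → ZMod 2) : List V → ZMod 2
  | [] => 0
  | v :: l => g l + d (fun m => g (v :: m)) l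

lemma d_add (g h : List V → ZMod 2) (l : List V) : d (g + h) l = d g l + d h l := by
  induction l generalizing g h with
  | nil => simp [d]
  | cons v l ih =>
    have := ih (fun m => g (v :: m)) (fun m => h (v :: m))
    simp only [d, Pi.add_apply]
    rw [show (fun m => g (v :: m) + h (v :: m)) =
      (fun m => g (v :: m)) + fun m => h (v :: m) from rfl, this]
    ring

lemma d_zero (l : List V) : d (0 : List V → ZMod 2) l = 0 := by
  induction l with
  | nil => rfl
  | cons v l ih => exact (zero_add _).trans ih

lemma d_cons (g : List V → ZMod 2) (v : V) :
    (fun m => d g (v :: m)) = g + d fun m => g (v :: m) := rfl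

lemma d_ofFn {n : ℕ} (g : List V → ZMod 2) (f : Fin (n + 1) → V) :
    d g (List.ofFn f) = ∑ i : Fin (n + 1), g (List.ofFn (f ∘ i.succAbove)) := by
  induction n generalizing g with
  | zero => simp [d]
  | succ n ih =>
    rw [List.ofFn_succ, d, ih, Fin.sum_univ_succ (n := n + 1)]
    congr 1
    refine Finset.sum_congr rfl fun i _ => ?_
    rw [List.ofFn_succ (f := f ∘ i.succ.succAbove)]
    simp [Function.comp_def]

variable [LinearOrder V]

/-- The dual of the insertion of a vertex into a strictly increasing list; the insertion of a
vertex that is already present is zero. -/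
def ins (v : V) (g : List V → ZMod 2) : List V → ZMod 2
  | [] => g [v]
  | w :: l => if v < w then g (v :: w :: l) else if v = w then 0
      else ins v (fun m => g (w :: m)) l

/-- The dual of sorting; lists with repetitions are sent to zero. -/
def srt (g : List V → ZMod 2) : List V → ZMod 2
  | [] => g []
  | v :: l => srt (ins v g) l

/-- The homotopy between prepending and inserting a vertex. -/
def insHomotopy (v : V) (g : List V → ZMod 2) : List V → ZMod 2
  | [] => 0
  | w :: l => if v < w then 0 else if v = w then g (v :: v :: v :: l)
      else insHomotopy v (fun m => g (w :: m)) l + g (v :: w :: v :: l) + g (v :: v :: v :: l)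

/-- The homotopy between the identity and sorting. -/
def srtHomotopy (g : List V → ZMod 2) : List V → ZMod 2
  | [] => 0
  | v :: l => srtHomotopy (fun m => g (v :: m)) l + srt (insHomotopy v g) l

lemma ins_add (v : V) (g h : List V → ZMod 2) : ins v (g + h) = ins v g + ins v h := by
  funext l
  induction l generalizing g h with
  | nil => simp [ins]
  | cons w l ih =>
    have := ih (fun m => g (w :: m)) (fun m => h (w :: m))
    simp only [ins, Pi.add_apply] at this ⊢
    split_ifs
    · rfl
    · simp
    · exact this

lemma srt_add (g h : List V → ZMod 2) : srt (g + h) = srt g + srt h := by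
  funext l
  induction l generalizing g h with
  | nil => simp [srt]
  | cons w l ih => simp only [srt, ins_add, ih, Pi.add_apply]

lemma insHomotopy_add (v : V) (g h : List V → ZMod 2) :
    insHomotopy v (g + h) = insHomotopy v g + insHomotopy v h := by
  funext l
  induction l generalizing g h with
  | nil => simp [insHomotopy]
  | cons w l ih =>
    have := ih (fun m => g (w :: m)) (fun m => h (w :: m))
    simp only [insHomotopy, Pi.add_apply] at this ⊢
    split_ifs
    · simp
    · rfl
    · rw [show (fun m => g (w :: m) + h (w :: m)) =
        (fun m => g (w :: m)) + fun m => h (w :: m) from rfl, this]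
      ring

lemma srtHomotopy_add (g h : List V → ZMod 2) :
    srtHomotopy (g + h) = srtHomotopy g + srtHomotopy h := by
  funext l
  induction l generalizing g h with
  | nil => simp [srtHomotopy]
  | cons w l ih =>
    have := ih (fun m => g (w :: m)) (fun m => h (w :: m))
    simp only [srtHomotopy, Pi.add_apply, insHomotopy_add, srt_add] at this ⊢
    rw [show (fun m => g (w :: m) + h (w :: m)) =
      (fun m => g (w :: m)) + fun m => h (w :: m) from rfl, this]
    ring

lemma ins_congr {v : V} {g h : List V → ZMod 2} {l : List V} (hl : l.Pairwise (· < ·))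
    (H : ∀ m : List V, m.Pairwise (· < ·) → m ⊆ v :: l → m.length = l.length + 1 → g m = h m) :
    ins v g l = ins v h l := by
  induction l generalizing g h with
  | nil => exact H _ (by simp) (by simp) rfl
  | cons w l ih =>
    rw [List.pairwise_cons] at hl
    simp only [ins]
    split_ifs with h1 h2
    · refine H _ ?_ (by simp) rfl
      simp only [List.pairwise_cons, List.mem_cons, forall_eq_or_imp]
      exact ⟨⟨h1, fun a ha => h1.trans (hl.1 a ha)⟩, hl⟩
    · rfl
    · refine ih hl.2 fun m hm hs hlen => H _ ?_ ?_ (by simp [hlen])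
      · refine List.pairwise_cons.2 ⟨fun a ha => ?_, hm⟩
        rcases List.mem_cons.1 (hs ha) with rfl | h3
        · exact lt_of_le_of_ne (not_lt.1 h1) (Ne.symm h2)
        · exact hl.1 a h3
      · intro a ha
        rcases List.mem_cons.1 ha with rfl | ha
        · simp
        · have := hs ha
          simp only [List.mem_cons] at this ⊢
          tauto

/-- This lets identities that hold only on strictly increasing lists be used under `srt`. -/
lemma srt_congr {g h : List V → ZMod 2} {l : List V}
    (H : ∀ m : List V, m.Pairwise (· < ·) → m ⊆ l → m.length = l.length → g m = h m) :
    srt g l = srt h l := by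
  induction l generalizing g h with
  | nil => exact H _ (by simp) (by simp) rfl
  | cons w l ih =>
    refine ih fun m hm hs hlen => ins_congr hm fun m' hm' hs' hlen' => H m' hm' ?_ ?_
    · exact List.Subset.trans hs' (List.cons_subset_cons w hs)
    · simp [hlen', hlen]

lemma srt_zero (l : List V) : srt (0 : List V → ZMod 2) l = 0 := by
  have := congrFun (srt_add (0 : List V → ZMod 2) 0) l
  simpa using this

lemma srtHomotopy_zero (l : List V) : srtHomotopy (0 : List V → ZMod 2) l = 0 := by
  have := congrFun (srtHomotopy_add (0 : List V → ZMod 2) 0) l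
  simpa using this

lemma insHomotopy_congr {v : V} {g h : List V → ZMod 2} {l : List V}
    (H : ∀ m : List V, m ⊆ v :: l → m.length = l.length + 2 → g m = h m) :
    insHomotopy v g l = insHomotopy v h l := by
  induction l generalizing g h with
  | nil => rfl
  | cons w l ih =>
    have h3 : g (v :: v :: v :: l) = h (v :: v :: v :: l) :=
      H _ (by intro a; simp; tauto) (by simp)
    simp only [insHomotopy]
    split_ifs
    · rfl
    · exact h3
    · rw [h3, H (v :: w :: v :: l) (by intro a; simp; tauto) (by simp), ih]
      refine fun m hs hlen => H _ ?_ (by simp [hlen])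
      intro a ha
      rcases List.mem_cons.1 ha with rfl | ha
      · simp
      · have := hs ha
        simp only [List.mem_cons] at this ⊢
        tauto

/-- The homotopy introduces no new vertices, so on a simplex of a complex it stays within one face.
-/
lemma srtHomotopy_congr {g h : List V → ZMod 2} {l : List V}
    (H : ∀ m : List V, m ⊆ l → m.length = l.length + 1 → g m = h m) :
    srtHomotopy g l = srtHomotopy h l := by
  induction l generalizing g h with
  | nil => rfl
  | cons w l ih =>
    simp only [srtHomotopy]
    congr 1
    · exact ih fun m hs hlen => H _ (List.cons_subset_cons w hs) (by simp [hlen])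
    · refine srt_congr fun m _ hs hlen => insHomotopy_congr fun m' hs' hlen' => H m' ?_ ?_
      · exact List.Subset.trans hs' (List.cons_subset_cons w hs)
      · simp [hlen', hlen]

lemma ins_of_lt {v : V} {g : List V → ZMod 2} {l : List V} (h : ∀ a ∈ l, v < a) :
    ins v g l = g (v :: l) := by
  cases l with
  | nil => rfl
  | cons w l => rw [ins, if_pos (h w (by simp))]

lemma insHomotopy_of_lt {v : V} {g : List V → ZMod 2} {l : List V} (h : ∀ a ∈ l, v < a) :
    insHomotopy v g l = 0 := by
  cases l with
  | nil => rfl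
  | cons w l => rw [insHomotopy, if_pos (h w (by simp))]

/-- Dual to `∂ (insert v l) = l + insert v (∂ l)`. If `v` already lies in `l`, the left side is
zero, and on the right deleting and reinserting `v` gives `l` back, which cancels mod 2. -/
lemma ins_d {v : V} (g : List V → ZMod 2) {l : List V} (hl : l.Pairwise (· < ·)) :
    ins v (d g) l = g l + d (ins v g) l := by
  induction l generalizing g with
  | nil => simp [ins, d]
  | cons w l ih =>
    rw [List.pairwise_cons] at hl
    rcases lt_trichotomy v w with h | rfl | h
    · have h1 : (fun m => ins v g (w :: m)) = fun m => g (v :: w :: m) := by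
        funext m
        rw [ins, if_pos h]
      rw [ins, if_pos h, d, d, d, h1, ins_of_lt fun a ha => h.trans (hl.1 a ha)]
    · have h1 : (fun m => ins v g (v :: m)) = 0 := by
        funext m
        simp [ins]
      rw [d, h1, d_zero, ins_of_lt hl.1, ins, if_neg (lt_irrefl v), if_pos rfl, add_zero,
        CharTwo.add_self_eq_zero]
    · have h1 : (fun m => ins v g (w :: m)) = ins v fun m => g (w :: m) := by
        funext m
        rw [ins, if_neg h.not_gt, if_neg h.ne']
      rw [d, h1, ins, if_neg h.not_gt, if_neg h.ne', d_cons, ins_add, Pi.add_apply, ih _ hl.2]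
      ring

lemma srt_d (g : List V → ZMod 2) (l : List V) : srt (d g) l = d (srt g) l := by
  induction l generalizing g with
  | nil => rfl
  | cons v l ih =>
    have h1 : srt (ins v (d g)) l = srt (g + d (ins v g)) l :=
      srt_congr fun m hm _ _ => ins_d g hm
    rw [srt, h1, srt_add, Pi.add_apply, ih, d]
    rfl

/-- To move `v` past a smaller `w`, the simplex `v w v l` has faces `v w l` and `w v l`, but also
the unwanted `v v l`. The simplex `v v v l` has `v v l` as a face three times, hence once mod 2, and
cancels it. -/
lemma insHomotopy_d {v : V} (g : List V → ZMod 2) {l : List V} (hl : l.Pairwise (· < ·)) :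
    insHomotopy v (d g) l + d (insHomotopy v g) l = g (v :: l) + ins v g l := by
  induction l generalizing g with
  | nil => simp [ins, d, insHomotopy, CharTwo.add_self_eq_zero]
  | cons w l ih =>
    rw [List.pairwise_cons] at hl
    rcases lt_trichotomy v w with h | rfl | h
    · have h1 : (fun m => insHomotopy v g (w :: m)) = 0 := by
        funext m
        rw [insHomotopy, if_pos h, Pi.zero_apply]
      rw [ins, if_pos h, insHomotopy, if_pos h, d, h1, d_zero,
        insHomotopy_of_lt fun a ha => h.trans (hl.1 a ha), CharTwo.add_self_eq_zero]
      exact (CharTwo.add_self_eq_zero _).symm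
    · have h1 : (fun m => insHomotopy v g (v :: m)) = fun m => g (v :: v :: v :: m) := by
        funext m
        simp [insHomotopy]
      rw [d, h1, insHomotopy_of_lt hl.1, ins, insHomotopy]
      simp only [lt_irrefl, if_false, if_true, d]
      grind
    · have h1 : (fun m => insHomotopy v g (w :: m)) = (insHomotopy v fun m => g (w :: m)) +
          (fun m => g (v :: w :: v :: m)) + fun m => g (v :: v :: v :: m) := by
        funext m
        rw [insHomotopy, if_neg h.not_gt, if_neg h.ne']
        rfl
      have := ih (fun m => g (w :: m)) hl.2
      rw [d, h1, d_add, d_add, ins, insHomotopy, if_neg h.not_gt, if_neg h.ne', if_neg h.not_gt,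
        if_neg h.ne', d_cons, insHomotopy_add, Pi.add_apply]
      simp only [d]
      grind

/-- Sorting is homotopic to the identity. -/
lemma srtHomotopy_d (g : List V → ZMod 2) (l : List V) :
    srtHomotopy (d g) l + d (srtHomotopy g) l = g l + srt g l := by
  induction l generalizing g with
  | nil => simp [srt, d, srtHomotopy, CharTwo.add_self_eq_zero]
  | cons v l ih =>
    have h1 : (fun m => srtHomotopy g (v :: m)) =
        (srtHomotopy fun m => g (v :: m)) + srt (insHomotopy v g) := rfl
    have h2 : srt (insHomotopy v (d g)) l + d (srt (insHomotopy v g)) l =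
        srt (fun m => g (v :: m)) l + srt (ins v g) l := by
      rw [← srt_d, ← Pi.add_apply, ← srt_add, ← Pi.add_apply (srt _), ← srt_add]
      exact srt_congr fun m hm _ _ => insHomotopy_d g hm
    have := ih fun m => g (v :: m)
    rw [d, h1, d_add, srtHomotopy, d_cons, srtHomotopy_add, srt, Pi.add_apply]
    grind

end ListCochain

/-! ### Cuts -/

open Classical in
/-- Any finite family of edges, labelled by `w` and with distinct endpoints unless the label is
zero, admits a `ZMod 2`-valued function on the vertices such that the labels can be made to vanish
on at least half of the edges. -/
lemma exists_cut {α V : Type*} (S : Finset α) (w : α → ZMod 2) (a b : α → V)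
    (h : ∀ x ∈ S, a x ≠ b x ∨ w x = 0) :
    ∃ c : V → ZMod 2, 2 * (S.filter fun x => w x + (c (a x) + c (b x)) ≠ 0).card ≤ S.card := by
  -- `V` may be infinite, so the average runs over the subsets of the finite set of endpoints.
  set T : Finset V := S.image a ∪ S.image b
  let c : Finset V → V → ZMod 2 := fun U v => if v ∈ U then 1 else 0
  have key : ∀ x ∈ S,
      2 * (T.powerset.filter fun U => w x + (c U (a x) + c U (b x)) ≠ 0).card ≤
        T.powerset.card := by
    intro x hx
    have ha : a x ∈ T := Finset.mem_union_left _ (Finset.mem_image_of_mem a hx)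
    have hcard : (T.powerset.filter fun U => w x + (c U (a x) + c U (b x)) ≠ 0).card ≤
        (T.powerset.filter fun U => ¬ (w x + (c U (a x) + c U (b x)) ≠ 0)).card := by
      by_cases hab : a x = b x
      · have hw : w x = 0 := (h x hx).resolve_left (not_not.2 hab)
        simp [hab, hw, CharTwo.add_self_eq_zero]
      -- Toggling `a x` leaves `b x` alone and so flips the label of `x`.
      · refine Finset.card_le_card_of_injOn (fun U => symmDiff U {a x}) ?_ ?_
        · intro U hU
          simp only [Finset.coe_filter, Finset.mem_powerset, Set.mem_ofPred_eq] at hU ⊢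
          refine ⟨?_, ?_⟩
          · intro v hv
            rw [Finset.mem_symmDiff, Finset.mem_singleton] at hv
            rcases hv with hv | hv
            · exact hU.1 hv.1
            · exact hv.1 ▸ ha
          · have h1 : c (symmDiff U {a x}) (a x) = c U (a x) + 1 := by
              by_cases hv : a x ∈ U <;> simp [c, Finset.mem_symmDiff, hv, CharTwo.add_self_eq_zero]
            have h2 : c (symmDiff U {a x}) (b x) = c U (b x) := by
              simp [c, Finset.mem_symmDiff, Ne.symm hab]
            rw [h1, h2, not_not]
            have key : ∀ p q r : ZMod 2, p + (q + r) ≠ 0 → p + (q + 1 + r) = 0 := by decide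
            exact key _ _ _ hU.2
        · intro U _ U' _ hUU
          exact symmDiff_left_injective _ hUU
    have := Finset.card_filter_add_card_filter_not (s := T.powerset)
      fun U => w x + (c U (a x) + c U (b x)) ≠ 0
    omega
  by_contra! hc
  have h1 : ∑ U ∈ T.powerset, S.card <
      ∑ U ∈ T.powerset, 2 * (S.filter fun x => w x + (c U (a x) + c U (b x)) ≠ 0).card :=
    Finset.sum_lt_sum_of_nonempty ⟨∅, by simp⟩ fun U _ => hc (c U)
  have h2 : ∑ U ∈ T.powerset, 2 * (S.filter fun x => w x + (c U (a x) + c U (b x)) ≠ 0).card =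
      ∑ x ∈ S, 2 * (T.powerset.filter fun U => w x + (c U (a x) + c U (b x)) ≠ 0).card := by
    simp only [Finset.card_filter, Finset.mul_sum]
    exact Finset.sum_comm
  have h3 := Finset.sum_le_sum key
  simp only [Finset.sum_const, smul_eq_mul] at h1 h3
  rw [h2, mul_comm] at h1
  exact absurd h3 (not_le.2 h1)

open Classical in
-- Each cut is chosen for the survivors of the preceding ones, so every step halves their number.
lemma exists_cuts {α V : Type*} (S : Finset α) {n : ℕ} (w : Fin n → α → ZMod 2)
    (a b : Fin n → α → V) (h : ∀ i, ∀ x ∈ S, a i x ≠ b i x ∨ w i x = 0) :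
    ∃ c : Fin n → V → ZMod 2,
      2 ^ n * (S.filter fun x => ∀ i, w i x + (c i (a i x) + c i (b i x)) ≠ 0).card ≤ S.card := by
  induction n generalizing S with
  | zero => exact ⟨fun i => i.elim0, by simp⟩
  | succ n ih =>
    obtain ⟨c₀, hc₀⟩ := exists_cut S (w 0) (a 0) (b 0) (h 0)
    obtain ⟨c, hc⟩ := ih (S.filter fun x => w 0 x + (c₀ (a 0 x) + c₀ (b 0 x)) ≠ 0)
      (fun i => w i.succ) (fun i => a i.succ) (fun i => b i.succ)
      fun i x hx => h _ x (Finset.mem_filter.1 hx).1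
    refine ⟨Fin.cons c₀ c, ?_⟩
    simp only [Fin.forall_fin_succ, Fin.cons_zero, Fin.cons_succ]
    rw [Finset.filter_filter] at hc
    rw [pow_succ]
    linarith

/-! ### The counting bound for products of degree-one classes -/

namespace SSet

open Simplicial

section

variable {X : SSet.{u}} {R : Type v} [CommRing R]

lemma interval_interval_zero {n : ℕ} (p j l : ℕ) (hp : p ≤ n) (h : j + l ≤ p) (x : X _⦋n⦌) :
    interval j l h (interval 0 p (by omega) x) = interval j l (by omega) x := by
  simp only [interval, ← Functor.map_comp_apply, ← op_comp]
  exact map_op_congr _ _ (fun s => rfl) x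

/-- The cup product of the classes of the `1`-cocycles `z i` is represented by the product of
their values on the consecutive edges. -/
lemma exists_cupProd_eq_mk {n : ℕ} (z : Fin n → X.cocycles R 1) :
    ∃ y : X.cocycles R n,
      cupProd n (fun i => (Submodule.Quotient.mk (z i) : X.Cohomology R 1)) =
        Submodule.Quotient.mk y ∧
      y.1 = fun x => ∏ i : Fin n, (z i).1 (interval i.1 1 (by omega) x) := by
  induction n with
  | zero => exact ⟨_, rfl, by simp⟩
  | succ n ih =>
    obtain ⟨y, hy, hy'⟩ := ih fun i => z i.castSucc
    refine ⟨⟨cupCochain rfl y.1 (z (Fin.last n)).1,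
      cupCochain_mem_cocycles rfl y.2 (z (Fin.last n)).2⟩, ?_, ?_⟩
    · rw [cupProd, hy]
      rfl
    · funext x
      simp only [cupCochain, hy', Fin.prod_univ_castSucc]
      congr 1
      refine Finset.prod_congr rfl fun i _ => ?_
      rw [interval_interval_zero n _ _ (by omega)]
      rfl

lemma coboundary_mem_cocycles (c : X.Cochain R 0) :
    X.coboundary R 0 c ∈ X.cocycles R 1 := by
  rw [cocycles, LinearMap.mem_ker]
  funext x
  have h1 : X.δ 0 (X.δ 1 x) = X.δ 0 (X.δ 0 x) := δ_comp_δ_apply (i := 0) (j := 0) le_rfl x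
  have h2 : X.δ 0 (X.δ 2 x) = X.δ 1 (X.δ 0 x) := δ_comp_δ_apply (i := 0) (j := 1) (by simp) x
  have h3 : X.δ 1 (X.δ 2 x) = X.δ 1 (X.δ 1 x) := δ_comp_δ_apply (i := 1) (j := 1) le_rfl x
  rw [coboundary_apply, Fin.sum_univ_three, coboundary_apply, coboundary_apply, coboundary_apply,
    Fin.sum_univ_two, Fin.sum_univ_two, Fin.sum_univ_two, h1, h2, h3]
  simp only [Fin.val_zero, Fin.val_one, Fin.val_two, Pi.zero_apply]
  ring

/-- If products of `1`-cocycles that vanish on the set `S` of `n`-simplices are coboundaries, and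
the consecutive edges of the simplices in `S` have distinct endpoints or are annihilated by all
`1`-cocycles, then a non-zero product of `n` classes of degree one forces `2 ^ n` elements
of `S`. -/
lemma two_pow_le_encard {n : ℕ} (S : Set (X _⦋n⦌))
    (hS : ∀ z ∈ X.cocycles (ZMod 2) 1, ∀ x ∈ S, ∀ i : Fin n,
      X.δ 1 (interval i.1 1 (by omega) x) ≠ X.δ 0 (interval i.1 1 (by omega) x) ∨
        z (interval i.1 1 (by omega) x) = 0)
    (hS' : ∀ z : Fin n → X.cocycles (ZMod 2) 1,
      (fun x => ∏ i : Fin n, (z i).1 (interval i.1 1 (by omega) x)) ∈ X.cocycles (ZMod 2) n →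
      (∀ x ∈ S, ∏ i : Fin n, (z i).1 (interval i.1 1 (by omega) x) = 0) →
      (fun x => ∏ i : Fin n, (z i).1 (interval i.1 1 (by omega) x)) ∈
        X.coboundaries (ZMod 2) n)
    (ξ : Fin n → X.Cohomology (ZMod 2) 1) (hξ : cupProd n ξ ≠ 0) :
    2 ^ n ≤ S.encard := by
  classical
  rcases S.finite_or_infinite with hfin | hinf
  swap
  · simp [hinf.encard_eq]
  lift S to Finset (X _⦋n⦌) using hfin
  choose z hz using fun i => Submodule.Quotient.mk_surjective _ (ξ i)
  obtain ⟨c, hc⟩ := exists_cuts S (n := n)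
    (fun i x => (z i).1 (interval i.1 1 (by omega) x))
    (fun i x => X.δ 1 (interval i.1 1 (by omega) x))
    (fun i x => X.δ 0 (interval i.1 1 (by omega) x))
    (fun i x hx => hS _ (z i).2 x hx i)
  let z' (i : Fin n) : X.cocycles (ZMod 2) 1 := z i + ⟨_, coboundary_mem_cocycles (c i)⟩
  have hz' (i : Fin n) : (Submodule.Quotient.mk (z' i) : X.Cohomology (ZMod 2) 1) = ξ i := by
    rw [← hz i, Submodule.Quotient.eq]
    change (z i).1 + X.coboundary (ZMod 2) 0 (c i) - (z i).1 ∈ LinearMap.range _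
    rw [add_sub_cancel_left]
    exact ⟨_, rfl⟩
  have hval (i : Fin n) (e : X _⦋1⦌) :
      (z' i).1 e = (z i).1 e + (c i (X.δ 1 e) + c i (X.δ 0 e)) := by
    change (z i).1 e + X.coboundary (ZMod 2) 0 (c i) e = _
    rw [coboundary_apply, Fin.sum_univ_two]
    simp [ZModModule.neg_eq_self, add_comm]
  obtain ⟨y, hy, hy'⟩ := exists_cupProd_eq_mk z'
  simp only [hz'] at hy
  rw [Set.encard_coe_eq_coe_finsetCard]
  refine le_trans ?_ (Nat.cast_le.2 hc)
  rw [Nat.cast_mul, Nat.cast_pow, Nat.cast_ofNat]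
  -- It suffices that one simplex of `S` survives all cuts; otherwise the adjusted product vanishes
  -- on `S`.
  refine le_mul_of_one_le_right' ?_
  rw [Nat.one_le_cast, Nat.one_le_iff_ne_zero, Finset.card_ne_zero]
  by_contra hemp
  rw [Finset.not_nonempty_iff_eq_empty, Finset.filter_eq_empty_iff] at hemp
  refine hξ ?_
  rw [hy, Submodule.Quotient.mk_eq_zero]
  change y.1 ∈ X.coboundaries (ZMod 2) n
  rw [hy']
  refine hS' z' (hy' ▸ y.2) fun x hx => ?_
  have := hemp hx
  push Not at this
  obtain ⟨i, hi⟩ := this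
  exact Finset.prod_eq_zero (Finset.mem_univ i) ((hval _ _).trans hi)

end

/-! ### Degenerate simplices and edges of regular simplicial sets -/

section Regular

variable {X : SSet.{u}}

/-- All three faces of the doubly degenerate 2-simplex on `v` are this edge. -/
lemma cocycle_σ {z : X.Cochain (ZMod 2) 1} (hz : z ∈ X.cocycles (ZMod 2) 1) (v : X _⦋0⦌) :
    z (X.σ 0 v) = 0 := by
  have h := congrFun (LinearMap.mem_ker.1 hz) (X.σ 0 (X.σ 0 v))
  rw [coboundary_apply, Fin.sum_univ_three] at h
  have h1 := δ_comp_σ_self_apply (S := X) (0 : Fin 2) (X.σ 0 v)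
  have h2 := δ_comp_σ_succ_apply (S := X) (0 : Fin 2) (X.σ 0 v)
  have h3 := δ_comp_σ_of_gt_apply (S := X) (i := 1) (j := 0) (by simp) (X.σ 0 v)
  have h4 := δ_comp_σ_succ_apply (S := X) (0 : Fin 1) v
  simp only [Fin.castSucc_zero, Fin.succ_zero_eq_one] at h1 h2 h4
  replace h3 : X.δ 2 (X.σ 0 (X.σ 0 v)) = X.σ 0 (X.δ 1 (X.σ 0 v)) := h3
  rw [h1, h2, h3, h4] at h
  simpa [ZModModule.add_self] using h

/-- The `i`-th consecutive edge of `σ i y` is degenerate, which kills the `i`-th factor. -/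
lemma prod_cocycle_eq_zero_of_degenerate {n : ℕ} (z : Fin n → X.cocycles (ZMod 2) 1)
    {x : X _⦋n⦌} (hx : x ∈ X.degenerate n) :
    ∏ i : Fin n, (z i).1 (interval i.1 1 (by omega) x) = 0 := by
  cases n with
  | zero => simp at hx
  | succ n =>
    rw [degenerate_eq_iUnion_range_σ, Set.mem_iUnion] at hx
    obtain ⟨i, y, rfl⟩ := hx
    refine Finset.prod_eq_zero (Finset.mem_univ i) ?_
    have : interval i.1 1 (by omega) (X.σ i y) = X.σ 0 (interval i.1 0 (by omega) y) := by
      simp only [interval, SimplicialObject.σ_def, ← Functor.map_comp_apply, ← op_comp]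
      refine map_op_congr _ _ (fun s => ?_) y
      change (Fin.predAbove i ⟨s.1 + i.1, by omega⟩).1 = (Fin.predAbove (0 : Fin 1) s).1 + i.1
      fin_cases s <;> simp [Fin.predAbove, Fin.lt_def]
    rw [this]
    exact cocycle_σ (z i).2 _

/-- The endpoints of a nondegenerate edge of a regular simplicial set are distinct. -/
lemma IsRegular.δ_one_ne_δ_zero (hX : X.IsRegular) {e : X _⦋1⦌} (he : e ∈ X.nonDegenerate 1) :
    X.δ 1 e ≠ X.δ 0 e := by
  intro h
  have sq := hX 0 e he
  -- The identity of `Δ[1]` and the constant map at its vertex `0`, the last face, glue over the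
  -- pushout to a map `⟨e⟩ ⟶ Δ[1]` that separates the endpoints of `e`.
  let c : (Subcomplex.ofSimplex (X.δ (Fin.last 1) e)).toSSet ⟶ Δ[1] :=
    SSet.const (stdSimplex.objEquiv.symm (SimplexCategory.δ 1))
  have hc : stdSimplex.δ (Fin.last 1) ≫ 𝟙 _ =
      Subcomplex.toOfSimplex (X.δ (Fin.last 1) e) ≫ c := by
    apply yonedaEquiv.injective
    rw [yonedaEquiv_comp, yonedaEquiv_comp]
    apply stdSimplex.objEquiv.injective
    ext i : 3
    fin_cases i
    rfl
  let r := sq.desc (𝟙 _) c hc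
  have hr : Subcomplex.toOfSimplex e ≫ r = 𝟙 _ := sq.inl_desc _ _ _
  have ht : r.app (op ⦋1⦌) ⟨e, Subcomplex.mem_ofSimplex_obj e⟩ =
      stdSimplex.objEquiv.symm (𝟙 ⦋1⦌) := by
    have := congrArg yonedaEquiv hr
    rw [yonedaEquiv_comp, Subcomplex.yonedaEquiv_toOfSimplex] at this
    exact this
  have hδ (i : Fin 2) : r.app (op ⦋0⦌) ((Subcomplex.ofSimplex e).toSSet.δ i
      ⟨e, Subcomplex.mem_ofSimplex_obj e⟩) =
      stdSimplex.objEquiv.symm (SimplexCategory.δ i) := by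
    exact (δ_naturality_apply r i _).trans (congrArg (Δ[1].δ i) ht)
  have h01 : (SimplexCategory.δ 1 : ⦋0⦌ ⟶ ⦋1⦌) = SimplexCategory.δ 0 := by
    apply stdSimplex.objEquiv.symm.injective
    rw [← hδ, ← hδ]
    exact congrArg (r.app (op ⦋0⦌)) (Subtype.ext h)
  have := congrArg (fun f : ⦋0⦌ ⟶ ⦋1⦌ => (f.toOrderHom 0 : Fin 2)) h01
  revert this
  decide

end Regular

end SSet

/-! ### Ordered and strictly increasing simplices of a simplicial complex -/

namespace PreAbstractSimplicialComplex

open Simplicial SSet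

variable {V : Type u} {K : PreAbstractSimplicialComplex V}

lemma ofFn_injective (K : PreAbstractSimplicialComplex V) (n : ℕ) :
    Function.Injective fun x : K.ordered _⦋n⦌ => List.ofFn x.1 := fun _ _ h =>
  Subtype.ext (List.ofFn_injective h)

lemma exists_ofFn_eq {n k : ℕ} (x : K.ordered _⦋n⦌) {m : List V} (hm : m ⊆ List.ofFn x.1)
    (hlen : m.length = k + 1) : ∃ y : K.ordered _⦋k⦌, List.ofFn y.1 = m := by
  obtain ⟨s, hs, h⟩ := x.2
  have hms : ∀ a ∈ m, a ∈ s := fun a ha => by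
    obtain ⟨i, rfl⟩ := (List.mem_ofFn' _ _).1 (hm ha)
    exact h i
  refine ⟨⟨fun i => m.get (i.cast hlen.symm), s, hs, fun i => hms _ (List.get_mem _ _)⟩, ?_⟩
  exact (List.ofFn_congr hlen m.get).symm.trans (List.ofFn_get m)

/-- A function on ordered simplices as a function on lists, zero on other lists. -/
noncomputable def extendToLists {n : ℕ} (z : K.ordered.Cochain (ZMod 2) n) : List V → ZMod 2 :=
  Function.extend (fun x : K.ordered _⦋n⦌ => List.ofFn x.1) z 0

lemma extendToLists_ofFn {n : ℕ} (z : K.ordered.Cochain (ZMod 2) n) (x : K.ordered _⦋n⦌) :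
    extendToLists z (List.ofFn x.1) = z x :=
  (K.ofFn_injective n).extend_apply z 0 x

lemma coboundary_eq_d {n : ℕ} (g : List V → ZMod 2) (x : K.ordered _⦋n + 1⦌) :
    K.ordered.coboundary (ZMod 2) n (fun y => g (List.ofFn y.1)) x =
      ListCochain.d g (List.ofFn x.1) := by
  rw [coboundary_apply]
  refine Eq.trans ?_ (ListCochain.d_ofFn g x.1).symm
  refine Finset.sum_congr rfl fun i _ => ?_
  rw [ZModModule.neg_eq_self, one_pow, one_mul]
  rfl

/-- A mod 2 cocycle that vanishes on the strictly increasing simplices is a coboundary. -/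
lemma mem_coboundaries_of_strictMono [LinearOrder V] {n : ℕ} {z : K.ordered.Cochain (ZMod 2) n}
    (hz : z ∈ K.ordered.cocycles (ZMod 2) n)
    (h : ∀ x : K.ordered _⦋n⦌, StrictMono x.1 → z x = 0) :
    z ∈ K.ordered.coboundaries (ZMod 2) n := by
  cases n with
  | zero =>
    refine (Submodule.mem_bot _).2 (funext fun x => h x ?_)
    exact Subsingleton.strictMono (α := Fin 1) x.1
  | succ n =>
    have hz' := LinearMap.mem_ker.1 hz
    refine ⟨fun y => ListCochain.srtHomotopy (extendToLists z) (List.ofFn y.1), ?_⟩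
    funext x
    rw [coboundary_eq_d]
    have h1 := ListCochain.srtHomotopy_d (extendToLists z) (List.ofFn x.1)
    have h2 : ListCochain.srt (extendToLists z) (List.ofFn x.1) = 0 := by
      rw [← ListCochain.srt_zero (List.ofFn x.1)]
      refine ListCochain.srt_congr fun m hm hs hlen => ?_
      obtain ⟨y, rfl⟩ := exists_ofFn_eq (k := n + 1) x hs (by simpa using hlen)
      rw [extendToLists_ofFn]
      exact h y fun i j hij => List.pairwise_ofFn.1 hm hij
    -- The extension by zero need not be a cocycle on all lists, but it is one on lists of vertices
    -- of `x`, the only ones seen here.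
    have h3 : ListCochain.srtHomotopy (ListCochain.d (extendToLists z)) (List.ofFn x.1) = 0 := by
      rw [← ListCochain.srtHomotopy_zero (List.ofFn x.1)]
      refine ListCochain.srtHomotopy_congr fun m hs hlen => ?_
      obtain ⟨y, rfl⟩ := exists_ofFn_eq (k := n + 2) x hs (by simpa using hlen)
      rw [← coboundary_eq_d]
      simp only [extendToLists_ofFn]
      exact congrFun hz' y
    rwa [h2, h3, zero_add, add_zero, extendToLists_ofFn] at h1

/-- A strictly increasing sequence is determined by its set of vertices. -/
lemma encard_strictMono_le [LinearOrder V] (K : PreAbstractSimplicialComplex V) (n : ℕ) :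
    {x : K.ordered _⦋n⦌ | StrictMono x.1}.encard ≤
      {s | s ∈ K.faces ∧ s.card = n + 1}.encard := by
  refine Set.encard_le_encard_of_injOn (f := fun x => Finset.univ.image x.1) ?_ ?_
  · intro x hx
    obtain ⟨s, hs, h⟩ := x.2
    refine ⟨(K.isRelLowerSet_faces hs).2 ?_ ?_, ?_⟩
    · exact Finset.image_subset_iff.2 fun i _ => h i
    · exact Finset.univ_nonempty.image _
    · rw [Finset.card_image_of_injective _ hx.injective]
      exact Fintype.card_fin _
  · intro x hx y hy hxy
    refine Subtype.ext ((StrictMono.range_inj hx hy).1 ?_)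
    simpa using congrArg (fun s : Finset V => (s : Set V)) hxy

end PreAbstractSimplicialComplex

theorem corollary2 (n : ℕ) :
    (∀ (V : Type u) (K : PreAbstractSimplicialComplex V)
        (ξ : Fin n → K.ordered.Cohomology (ZMod 2) 1),
        SSet.cupProd n ξ ≠ 0 → 2 ^ n ≤ {s ∈ K.faces | s.card = n + 1}.encard) ∧
      (∀ (X : SSet.{u}), X.IsRegular →
        ∀ ξ : Fin n → X.Cohomology (ZMod 2) 1,
          SSet.cupProd n ξ ≠ 0 → 2 ^ n ≤ (X.nonDegenerate n).encard) := by
  refine ⟨fun V K ξ hξ => ?_, fun X hX ξ hξ => ?_⟩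
  · let _ : LinearOrder V := IsWellOrder.linearOrder WellOrderingRel
    refine le_trans (SSet.two_pow_le_encard _ (fun z _ x hx i => Or.inl fun h => ?_)
      (fun z hz h => ?_) ξ hξ) (K.encard_strictMono_le n)
    · have hx' : StrictMono x.1 := hx
      have h0 : x.1 ⟨i.1, by have := i.2; change i.1 < n + 1; omega⟩ =
          x.1 ⟨i.1 + 1, by have := i.2; change i.1 + 1 < n + 1; omega⟩ := by
        have := congrFun (congrArg Subtype.val h) 0
        refine Eq.trans (congrArg x.1 (Fin.ext ?_)) (this.trans (congrArg x.1 (Fin.ext ?_)))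
        · exact (Nat.zero_add _).symm
        · exact (Nat.add_comm 1 _)
      have := hx'.injective h0
      simp [Fin.ext_iff] at this
    · exact PreAbstractSimplicialComplex.mem_coboundaries_of_strictMono hz h
  · refine SSet.two_pow_le_encard _ (fun z hz x _ i => ?_) (fun z hz h => ?_) ξ hξ
    -- A nondegenerate simplex may have degenerate consecutive edges; cocycles vanish there.
    · by_cases he : SSet.interval i.1 1 (by omega) x ∈ X.nonDegenerate 1
      · exact Or.inl (hX.δ_one_ne_δ_zero he)
      · rw [← SSet.mem_degenerate_iff_notMem_nonDegenerate,
          SSet.degenerate_eq_iUnion_range_σ, Set.mem_iUnion] at he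
        obtain ⟨j, v, hv⟩ := he
        obtain rfl : j = 0 := Subsingleton.elim (α := Fin 1) j 0
        exact Or.inr (hv ▸ SSet.cocycle_σ hz v)
    · refine (congrArg (· ∈ X.coboundaries (ZMod 2) n) (funext fun x => ?_)).mpr
        (Submodule.zero_mem _)
      by_cases hx : x ∈ X.nonDegenerate n
      · exact h x hx
      · exact SSet.prod_cocycle_eq_zero_of_degenerate z
          ((SSet.mem_degenerate_iff_notMem_nonDegenerate _ x).2 hx)
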